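/- **Definitions.** A *finite quantum system* is a self-adjoint subalgebra with identity $\mathcal A\subseteq\mathcal L(\mathcal H)$ for a finite-dimensional complex Hilbert space $\mathcal H=\mathbb C^n$; $\operatorname{tr}$ is the trace of $\mathcal L(\mathcal H)$, and $\mathcal A^+$ is the set of positive operators in $\mathcal A$. A *physical state* is an $A\in\mathcal A^+$ with $\operatorname{tr}A=1$. A *physical map* (*quantum channel*) $\alpha_*\colon\mathcal A\to\mathcal B$ is a trace preserving $\mathbb C$-linear map that is completely positive, i.e. for every finite quantum system $\mathcal C$ the map $\sum_i a_i\otimes c_i\mapsto\sum_i\alpha_*(a_i)\otimes c_i$ from $\mathcal A\otimes\mathcal C$ to $\mathcal B\otimes\mathcal C$ sends positive elements to positive elements. A *measurement* is a physical map into a commutative finite quantum system. The von Neumann entropy is $H(X)=-\operatorname{tr}(X\log X)$, with $0\log 0=0$ and $\log$ the natural logarithm. A *spectral decomposition* of a physical state $A\in\mathcal A$ is $A=\sum_i a_iP_i$ with real $a_i$ and mutually orthogonal minimal projections $P_i$ of $\mathcal A$ that add up to $\mathbf 1$. (If $\mathcal A=\mathcal L(\mathcal H)$, then $P_i=|a_i\rangle\langle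 a_i|$ for an orthonormal basis of eigenvectors $|a_i\rangle$ of $A$.) Let $W_*\colon\mathcal A\to\mathcal B$ be a quantum channel. Put $$B=W_*(A),\qquad (A,B)=\sum_i a_i\,P_i\otimes W_*\!\left(\frac{P_i}{\operatorname{tr}P_i}\right),\qquad I(A;W_*)=H(A)+H(B)-H(A,B).$$ If $P_i=|a_i\rangle\langle a_i|$ has rank one, then $\operatorname{tr}P_i=1$ and its summand is $a_i|a_i\rangle\langle a_i|\otimes W_*(|a_i\rangle\langle a_i|)$. If $A$ has degenerate eigenvalues, $I(A;W_*)$ may depend on the chosen spectral decomposition. **Corollary (Holevo's upper bound).** Let $\mathcal A_1,\mathcal A_2,\mathcal A_3$ be finite quantum systems, $\mathcal A_3$ commutative. Let $W_*\colon\mathcal A_1\to\mathcal A_2$ be a quantum channel, $D_*\colon\mathcal A_2\to\mathcal A_3$ a measurement, and $A\in\mathcal A_1$ a physical state. Then, for every spectral decomposition of $A$, used on both sides, $$I(A;D_*\circ W_*)\le I(A;W_*).$$ -/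

import Mathlib

open scoped Matrix Kronecker ComplexOrder

/-- A finite quantum system on the Hilbert space `ℂⁿ`: a self-adjoint subalgebra, containing the
identity, of the algebra of all operators on `ℂⁿ` (matrices with respect to an orthonormal basis,
the involution being the conjugate transpose). -/
abbrev FiniteQuantumSystem (n : Type*) [Fintype n] [DecidableEq n] :=
  StarSubalgebra ℂ (Matrix n n ℂ)

namespace FiniteQuantumSystem

section Maps

variable {n m l : Type*} [Fintype n] [DecidableEq n] [Fintype m] [DecidableEq m]
  [Fintype l] [DecidableEq l]
variable {𝒜 : FiniteQuantumSystem n} {ℬ : FiniteQuantumSystem m}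

/-- A physical state: a positive element of trace one. -/
structure IsPhysicalState (A : 𝒜) : Prop where
  posSemidef : (A : Matrix n n ℂ).PosSemidef
  trace_eq_one : (A : Matrix n n ℂ).trace = 1

/-- Complete positivity: for every finite quantum system `𝒞`, the map
`∑ aᵢ ⊗ cᵢ ↦ ∑ α(aᵢ) ⊗ cᵢ` from `𝒜 ⊗ 𝒞` to `ℬ ⊗ 𝒞` sends positive elements to positive elements.
Elements of `𝒜 ⊗ 𝒞` are realised as operators on `ℂⁿ ⊗ ℂᵏ` by the Kronecker product. -/
def IsCompletelyPositive (α : 𝒜 →ₗ[ℂ] ℬ) : Prop :=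
  ∀ (k : ℕ) (𝒞 : FiniteQuantumSystem (Fin k)) (r : ℕ) (a : Fin r → 𝒜) (c : Fin r → 𝒞),
    (∑ i, (a i : Matrix n n ℂ) ⊗ₖ (c i : Matrix (Fin k) (Fin k) ℂ)).PosSemidef →
    (∑ i, (α (a i) : Matrix m m ℂ) ⊗ₖ (c i : Matrix (Fin k) (Fin k) ℂ)).PosSemidef

/-- A physical map (quantum channel): a trace preserving, completely positive `ℂ`-linear map. -/
structure IsPhysicalMap (α : 𝒜 →ₗ[ℂ] ℬ) : Prop where
  trace_preserving : ∀ a : 𝒜, (α a : Matrix m m ℂ).trace = (a : Matrix n n ℂ).trace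
  completelyPositive : IsCompletelyPositive α

/-- A measurement: a physical map into a commutative algebra. -/
structure IsMeasurement (α : 𝒜 →ₗ[ℂ] ℬ) : Prop where
  isPhysicalMap : IsPhysicalMap α
  commutative : ∀ x y : ℬ, x * y = y * x

/-- A minimal projection of the system `𝒜`. For `𝒜` the algebra of all operators these are the
projections `|v⟩⟨v|` onto a line. -/
structure IsMinimalProjection (p : 𝒜) : Prop where
  isStarProjection : IsStarProjection p
  ne_zero : p ≠ 0
  minimal : ∀ q : 𝒜, IsStarProjection q → p * q = q → q = 0 ∨ q = p

/-- A spectral decomposition `A = ∑ᵢ aᵢ |aᵢ⟩⟨aᵢ|` inside the system `𝒜`, with real eigenvalues `aᵢ`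
(repeated according to multiplicity). The projections `|aᵢ⟩⟨aᵢ|` are mutually orthogonal minimal
projections of `𝒜` that add up to the identity; if `𝒜` is the algebra of all operators, this is
the same as an orthonormal basis of eigenvectors of `A`, up to phases. -/
structure SpectralDecomposition (A : 𝒜) (ι : Type*) [Fintype ι] where
  eigenvalue : ι → ℝ
  proj : ι → 𝒜
  isMinimalProjection : ∀ i, IsMinimalProjection (proj i)
  orthogonal : ∀ i j, i ≠ j → proj i * proj j = 0
  sum_proj : ∑ i, proj i = 1
  sum_eigenvalue_smul_proj : A = ∑ i, (eigenvalue i : ℂ) • proj i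

/-- The von Neumann entropy `H(X) = -tr (X log X)`, with the convention `0 log 0 = 0`. -/
noncomputable def entropy (X : Matrix n n ℂ) : ℝ :=
  -(X * cfc Real.log X).trace.re

namespace SpectralDecomposition

variable {A : 𝒜} {ι : Type*} [Fintype ι]

/-- The pure physical state of the `i`-th projection, normalised to trace one. If the projection
is of the form `|v⟩⟨v|` with a unit vector `v`, its trace is one and this is the projection itself;
its trace is bigger only if the irreducible representation of `𝒜` in question
occurs several times in `ℂⁿ`. -/
noncomputable def pureState (S : SpectralDecomposition A ι) (i : ι) : 𝒜 :=
  (S.proj i : Matrix n n ℂ).trace⁻¹ • S.proj i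

/-- The joint state `(A, W A) = ∑ᵢ aᵢ |aᵢ⟩⟨aᵢ| ⊗ W(|aᵢ⟩⟨aᵢ|)` of input and output. -/
noncomputable def jointState (S : SpectralDecomposition A ι) (W : 𝒜 →ₗ[ℂ] ℬ) :
    Matrix (n × m) (n × m) ℂ :=
  ∑ i, (S.eigenvalue i : ℂ) •
    ((S.proj i : Matrix n n ℂ) ⊗ₖ (W (S.pureState i) : Matrix m m ℂ))

/-- The mutual information `I(A; W) = H(A) + H(W A) - H(A, W A)`. -/
noncomputable def mutualInformation (S : SpectralDecomposition A ι) (W : 𝒜 →ₗ[ℂ] ℬ) : ℝ :=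
  entropy (A : Matrix n n ℂ) + entropy (W A : Matrix m m ℂ) - entropy (S.jointState W)

end SpectralDecomposition

end Maps

end FiniteQuantumSystem

/-! With `ρᵢ = Pᵢ / tr Pᵢ` and `pᵢ = aᵢ tr Pᵢ`, the mutual information is `∑ pᵢ S(W ρᵢ ‖ W A)`
(`mutualInformation_eq_sum_relEntropy`), so the bound follows termwise from monotonicity of the
relative entropy under `D` (`relEntropy_map_le_of_commute`).

For the latter, write `ρ = ∑ xᵢ Rᵢ`, `σ = ∑ yⱼ Tⱼ`, `w = tr (Rᵢ Tⱼ)`. Then `S(ρ‖σ) = ∑ w x (log x -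
log y)` is a classical expression, and up to a divergence depending only on `tr ρ` it is the
integral over `t > 0` of `∑ w x² / (y + t x)`. It suffices to compare these sums for each `t`. Each
bounds `2 tr ρX - tr XσX - t tr XρX` for Hermitian `X`. Since the output system is commutative, the
joint spectral projections of `D ρ` and `D σ` pull back to a resolution `Eⱼ` of the identity; taking
`X = ∑ zⱼ Eⱼ`, the Kadison-Schwarz inequality and the optimal `zⱼ` give exactly the sum for the
outputs. -/

namespace Matrix

/-! ### Spectral resolutions and functional calculus in a matrix star subalgebra. -/

section SpectralResolution

variable {n ι : Type*} [Fintype n] [DecidableEq n] [Fintype ι]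

open scoped MatrixOrder in
theorem PosSemidef.trace_mul_nonneg {A B : Matrix n n ℂ} (hA : A.PosSemidef) (hB : B.PosSemidef) :
    0 ≤ (A * B).trace := by
  obtain ⟨C, rfl⟩ := CStarAlgebra.nonneg_iff_eq_star_mul_self.mp hB.nonneg
  rw [star_eq_conjTranspose, ← mul_assoc, trace_mul_comm, ← mul_assoc]
  exact (hA.mul_mul_conjTranspose_same C).trace_nonneg

theorem PosSemidef.re_trace_mul_nonneg {A B : Matrix n n ℂ} (hA : A.PosSemidef)
    (hB : B.PosSemidef) : 0 ≤ (A * B).trace.re :=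
  (Complex.nonneg_iff.1 (hA.trace_mul_nonneg hB)).1

/-- `X` is the combination, with real coefficients `x i`, of mutually orthogonal projections `R i`
that add up to the identity. -/
structure IsSpectralResolution (X : Matrix n n ℂ) (x : ι → ℝ) (R : ι → Matrix n n ℂ) : Prop where
  isHermitian : ∀ i, (R i).IsHermitian
  mul_self : ∀ i, R i * R i = R i
  mul_of_ne : ∀ i j, i ≠ j → R i * R j = 0
  sum_proj : ∑ i, R i = 1
  sum_smul_proj : X = ∑ i, (x i : ℂ) • R i

namespace IsSpectralResolution

variable {X : Matrix n n ℂ} {x : ι → ℝ} {R : ι → Matrix n n ℂ}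

theorem posSemidef_proj (h : IsSpectralResolution X x R) (i : ι) : (R i).PosSemidef := by
  have := Matrix.posSemidef_conjTranspose_mul_self (R i)
  rwa [(h.isHermitian i).eq, h.mul_self] at this

theorem mul_proj (h : IsSpectralResolution X x R) (i : ι) : X * R i = (x i : ℂ) • R i := by
  rw [h.sum_smul_proj, Finset.sum_mul, Finset.sum_eq_single i]
  · rw [smul_mul_assoc, h.mul_self]
  · intro j _ hj
    rw [smul_mul_assoc, h.mul_of_ne j i hj, smul_zero]
  · simp

theorem proj_mul (h : IsSpectralResolution X x R) (i : ι) : R i * X = (x i : ℂ) • R i := by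
  rw [h.sum_smul_proj, Finset.mul_sum, Finset.sum_eq_single i]
  · rw [mul_smul_comm, h.mul_self]
  · intro j _ hj
    rw [mul_smul_comm, h.mul_of_ne i j hj.symm, smul_zero]
  · simp

theorem trace_proj_nonneg (h : IsSpectralResolution X x R) (i : ι) : 0 ≤ (R i).trace :=
  (h.posSemidef_proj i).trace_nonneg

/-- A resolution may contain zero projections, whose coefficients are arbitrary; hence the sign
conditions below are always restricted to nonzero weights. -/
theorem val_nonneg (h : IsSpectralResolution X x R) (hX : X.PosSemidef) (i : ι) (hi : R i ≠ 0) :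
    0 ≤ x i := by
  have h1 := hX.trace_mul_nonneg (h.posSemidef_proj i)
  rw [h.mul_proj, trace_smul, smul_eq_mul] at h1
  have h2 : 0 < (R i).trace := lt_of_le_of_ne (h.trace_proj_nonneg i)
    fun h0 => hi ((h.posSemidef_proj i).trace_eq_zero_iff.1 h0.symm)
  have h3 := (Complex.lt_def.1 h2)
  have h1' := (Complex.nonneg_iff.1 h1).1
  simp only [Complex.re_ofReal_mul] at h1'
  exact nonneg_of_mul_nonneg_left h1' (by simpa using h3.1)

theorem isHermitian_self (h : IsSpectralResolution X x R) : X.IsHermitian := by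
  rw [h.sum_smul_proj]
  unfold IsHermitian
  rw [conjTranspose_sum]
  refine Finset.sum_congr rfl fun i _ => ?_
  rw [conjTranspose_smul, (h.isHermitian i).eq]
  simp

theorem aeval_eq (h : IsSpectralResolution X x R) (q : Polynomial ℝ) :
    Polynomial.aeval X q = ∑ i, ((q.eval (x i) : ℝ) : ℂ) • R i := by
  induction q using Polynomial.induction_on' with
  | add p q hp hq => simp [hp, hq, add_smul, Finset.sum_add_distrib]
  | monomial k c =>
    have hpow : X ^ k = ∑ i, ((x i : ℂ) ^ k) • R i := by
      induction k with
      | zero => simp [h.sum_proj]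
      | succ k ih =>
        rw [pow_succ', ih, Finset.mul_sum]
        refine Finset.sum_congr rfl fun i _ => ?_
        rw [mul_smul_comm, h.mul_proj, smul_smul, pow_succ]
    rw [Polynomial.aeval_monomial, hpow, Finset.mul_sum]
    refine Finset.sum_congr rfl fun i _ => ?_
    rw [← Algebra.smul_def, Polynomial.eval_monomial, ← Complex.coe_smul, smul_smul]
    push_cast
    rfl

theorem spectrum_subset (h : IsSpectralResolution X x R) : spectrum ℝ X ⊆ Set.range x := by
  intro r hr
  by_contra hne
  refine hr ?_
  have hx : ∀ i, (r : ℂ) - x i ≠ 0 := fun i h0 => hne ⟨i, by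
    have := sub_eq_zero.1 h0
    exact_mod_cast this.symm⟩
  -- The resolvent is explicit: `∑ (r - xᵢ)⁻¹ Rᵢ`.
  have key : (algebraMap ℝ (Matrix n n ℂ) r - X) * ∑ i, ((r : ℂ) - x i)⁻¹ • R i = 1 := by
    rw [Finset.mul_sum, ← h.sum_proj]
    refine Finset.sum_congr rfl fun i _ => ?_
    rw [mul_smul_comm, sub_mul, h.mul_proj, ← Algebra.smul_def, ← Complex.coe_smul, ← sub_smul,
      smul_smul, inv_mul_cancel₀ (hx i), one_smul]
  exact IsUnit.of_mul_eq_one _ key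

/-- Interpolating `f` at the finitely many values `x i` reduces to polynomials, so no continuity is
needed and `Real.log` is allowed at `0`. -/
theorem cfc_eq (h : IsSpectralResolution X x R) (f : ℝ → ℝ) :
    cfc f X = ∑ i, (f (x i) : ℂ) • R i := by
  classical
  let q := Lagrange.interpolate (Finset.univ.image x) id f
  have hq : ∀ i, q.eval (x i) = f (x i) := fun i =>
    Lagrange.eval_interpolate_at_node (v := id) f (Set.injOn_id _) (by simp)
  have h1 : cfc f X = cfc q.eval X := cfc_congr fun r hr => by
    obtain ⟨i, rfl⟩ := h.spectrum_subset hr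
    exact (hq i).symm
  rw [h1, cfc_polynomial q X (show IsSelfAdjoint X from h.isHermitian_self), h.aeval_eq]
  simp only [hq]

theorem trace_mul_cfc (h : IsSpectralResolution X x R) (f : ℝ → ℝ) :
    (X * cfc f X).trace = ∑ i, (f (x i) * x i : ℂ) * (R i).trace := by
  rw [h.cfc_eq, Finset.mul_sum, trace_sum]
  refine Finset.sum_congr rfl fun i _ => ?_
  rw [mul_smul_comm, h.mul_proj, smul_smul, trace_smul, smul_eq_mul]

end IsSpectralResolution

theorem cfc_mem_starSubalgebra (𝒜 : StarSubalgebra ℂ (Matrix n n ℂ)) {X : Matrix n n ℂ}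
    (hX : X.IsHermitian) (hmem : X ∈ 𝒜) (f : ℝ → ℝ) : cfc f X ∈ 𝒜 := by
  classical
  let s := X.finite_real_spectrum.toFinset
  let q := Lagrange.interpolate s id f
  have h1 : cfc f X = cfc q.eval X := cfc_congr fun r hr =>
    (Lagrange.eval_interpolate_at_node (v := id) f (Set.injOn_id _) (by simpa [s] using hr)).symm
  rw [h1, cfc_polynomial q X (show IsSelfAdjoint X from hX)]
  have h2 : Algebra.adjoin ℝ {X} ≤ 𝒜.toSubalgebra.restrictScalars ℝ :=
    Algebra.adjoin_le (Set.singleton_subset_iff.2 hmem)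
  exact h2 (Polynomial.aeval_mem_adjoin_singleton _ _)

/-- Every Hermitian element of a star subalgebra has a spectral resolution in that subalgebra. -/
theorem exists_isSpectralResolution (𝒜 : StarSubalgebra ℂ (Matrix n n ℂ)) {X : Matrix n n ℂ}
    (hX : X.IsHermitian) (hmem : X ∈ 𝒜) :
    ∃ (s : Finset ℝ) (R : s → Matrix n n ℂ),
      IsSpectralResolution X (fun i : s => (i : ℝ)) R ∧ ∀ i, R i ∈ 𝒜 := by
  classical
  have hX' : IsSelfAdjoint X := hX
  let s := X.finite_real_spectrum.toFinset
  have hc : ∀ f : ℝ → ℝ, ContinuousOn f (spectrum ℝ X) := fun f =>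
    X.finite_real_spectrum.continuousOn f
  -- Indicators of the single eigenvalues; their functional calculus gives the eigenprojections.
  let f : s → ℝ → ℝ := fun i r => if r = i then 1 else 0
  refine ⟨s, fun i => cfc (f i) X, ⟨?_, ?_, ?_, ?_, ?_⟩, ?_⟩
  · intro i
    exact cfc_predicate (f i) X
  · intro i
    rw [← cfc_mul _ _ X (hc _) (hc _)]
    congr 1
    ext r
    simp [f]
  · intro i j hij
    rw [← cfc_mul _ _ X (hc _) (hc _), ← cfc_const_zero ℝ X]
    congr 1
    ext r
    simp only [f, mul_ite, mul_one, mul_zero]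
    split_ifs with h1 h2
    · exact absurd (Subtype.ext (h2.symm.trans h1)) hij
    · rfl
    · rfl
  · rw [← cfc_sum_univ f X (fun i => hc _), ← cfc_const_one ℝ X]
    refine cfc_congr fun r hr => ?_
    have hr' : r ∈ s := by simpa [s] using hr
    simp only [Finset.sum_apply, f]
    rw [Finset.sum_eq_single ⟨r, hr'⟩]
    · simp
    · intro b _ hb
      exact if_neg fun h => hb (Subtype.ext h.symm)
    · simp
  · have : ∀ i : s, ((i : ℝ) : ℂ) • cfc (f i) X = cfc (fun r => (i : ℝ) * f i r) X := fun i => by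
      rw [cfc_const_mul _ _ _ (hc _), Complex.coe_smul]
    simp only [this]
    rw [← cfc_sum_univ (fun (i : s) r => (i : ℝ) * f i r) X (fun i => hc _)]
    conv_lhs => rw [← cfc_id ℝ X]
    refine cfc_congr fun r hr => ?_
    have hr' : r ∈ s := by simpa [s] using hr
    simp only [Finset.sum_apply, f]
    rw [Finset.sum_eq_single ⟨r, hr'⟩]
    · simp
    · intro b _ hb
      rw [if_neg fun h => hb (Subtype.ext h.symm), mul_zero]
    · simp
  · intro i
    exact cfc_mem_starSubalgebra 𝒜 hX hmem _

end SpectralResolution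

end Matrix

/-! ### Logarithmic sums as integrals of rational ones. -/

open Filter Topology in
theorem tendsto_log_add_mul_sub_log {x y : ℝ} (hx : 0 < x) :
    Tendsto (fun T : ℝ => Real.log (y + T * x) - Real.log T) atTop (𝓝 (Real.log x)) := by
  have h1 : Tendsto (fun T : ℝ => y / T + x) atTop (𝓝 (0 + x)) :=
    (tendsto_const_nhds.div_atTop tendsto_id).add tendsto_const_nhds
  rw [zero_add] at h1
  have h2 := h1.log hx.ne'
  refine h2.congr' ?_
  filter_upwards [eventually_gt_atTop 0, h1.eventually (lt_mem_nhds hx)] with T hT hpos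
  have : y + T * x = T * (y / T + x) := by field_simp
  rw [this, Real.log_mul hT.ne' hpos.ne']
  ring

theorem hasDerivAt_sum_mul_log_add_mul {ι : Type*} [Fintype ι] {w x y : ι → ℝ}
    (hx : ∀ i, w i ≠ 0 → 0 ≤ x i) (hy : ∀ i, w i * x i ≠ 0 → 0 < y i) {T : ℝ} (hT : 0 ≤ T) :
    HasDerivAt (fun T => ∑ i, w i * x i * (Real.log (y i + T * x i) - Real.log (y i)))
      (∑ i, w i * (x i ^ 2 / (y i + T * x i))) T := by
  refine HasDerivAt.fun_sum fun i _ => ?_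
  by_cases h0 : w i * x i = 0
  · have : w i * (x i ^ 2 / (y i + T * x i)) = 0 := by
      rw [pow_two, mul_div_assoc, ← mul_assoc, h0, zero_mul]
    simp only [h0, zero_mul, this]
    exact hasDerivAt_const _ _
  · have hpos : 0 < y i + T * x i := add_pos_of_pos_of_nonneg (hy i h0)
      (mul_nonneg hT (hx i (left_ne_zero_of_mul h0)))
    have h1 : HasDerivAt (fun T : ℝ => y i + T * x i) (x i) T := by
      simpa using ((hasDerivAt_id T).mul_const (x i)).const_add (y i)
    refine (((h1.log hpos.ne').sub_const (Real.log (y i))).const_mul (w i * x i)).congr_deriv ?_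
    ring

open Filter Topology in
-- Each term with `w x ≠ 0` grows like `w x log T`; subtracting the total mass times `log T` leaves
-- a finite limit.
theorem tendsto_sum_mul_log_add_mul {ι : Type*} [Fintype ι] {w x y : ι → ℝ}
    (hx : ∀ i, w i ≠ 0 → 0 ≤ x i) :
    Tendsto (fun T => ∑ i, w i * x i * (Real.log (y i + T * x i) - Real.log (y i))
        - (∑ i, w i * x i) * Real.log T) atTop
      (𝓝 (∑ i, w i * x i * (Real.log (x i) - Real.log (y i)))) := by
  simp only [Finset.sum_mul, ← Finset.sum_sub_distrib]
  refine tendsto_finsetSum _ fun i _ => ?_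
  by_cases h0 : w i * x i = 0
  · simp [h0]
  · have hxp : 0 < x i := lt_of_le_of_ne (hx i (left_ne_zero_of_mul h0))
      (right_ne_zero_of_mul h0).symm
    refine (((tendsto_log_add_mul_sub_log (y := y i) hxp).sub_const
      (Real.log (y i))).const_mul (w i * x i)).congr fun T => ?_
    ring

open Filter Topology in
/-- Comparison of `∑ w x (log x - log y)` from that of `∑ w x² / (y + t x)` for all `t > 0`. -/
theorem sum_mul_log_sub_log_le_of_sum_sq_div_le {ι κ : Type*} [Fintype ι] [Fintype κ]
    {w x y : ι → ℝ} {w' x' y' : κ → ℝ}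
    (hx : ∀ i, w i ≠ 0 → 0 ≤ x i) (hy : ∀ i, w i * x i ≠ 0 → 0 < y i)
    (hx' : ∀ j, w' j ≠ 0 → 0 ≤ x' j) (hy' : ∀ j, w' j * x' j ≠ 0 → 0 < y' j)
    (hmass : ∑ i, w i * x i = ∑ j, w' j * x' j)
    (h : ∀ t : ℝ, 0 < t → ∑ i, w i * (x i ^ 2 / (y i + t * x i)) ≤
      ∑ j, w' j * (x' j ^ 2 / (y' j + t * x' j))) :
    ∑ i, w i * x i * (Real.log (x i) - Real.log (y i)) ≤
      ∑ j, w' j * x' j * (Real.log (x' j) - Real.log (y' j)) := by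
  refine le_of_tendsto_of_tendsto (tendsto_sum_mul_log_add_mul hx)
    (tendsto_sum_mul_log_add_mul hx') ?_
  filter_upwards [eventually_ge_atTop 0] with T hT
  -- Equal masses make the divergent `log T` terms cancel.
  rw [hmass]
  refine sub_le_sub_right ?_ _
  -- The difference of the two sides vanishes at `T = 0`, and its derivative is the difference of
  -- the rational sums, so it is monotone.
  have hd : ∀ T : ℝ, 0 ≤ T → HasDerivAt
      (fun T => ∑ j, w' j * x' j * (Real.log (y' j + T * x' j) - Real.log (y' j)) -
        ∑ i, w i * x i * (Real.log (y i + T * x i) - Real.log (y i)))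
      (∑ j, w' j * (x' j ^ 2 / (y' j + T * x' j)) - ∑ i, w i * (x i ^ 2 / (y i + T * x i))) T :=
    fun T hT => (hasDerivAt_sum_mul_log_add_mul hx' hy' hT).sub
      (hasDerivAt_sum_mul_log_add_mul hx hy hT)
  have hmono := monotoneOn_of_deriv_nonneg (convex_Ici (0 : ℝ))
    (fun T hT => (hd T hT).continuousAt.continuousWithinAt)
    (fun T hT => (hd T (interior_subset hT)).differentiableAt.differentiableWithinAt)
    (fun T hT => by
      rw [(hd T (interior_subset hT)).deriv]
      exact sub_nonneg.2 (h T (by simpa using hT)))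
  have := hmono (Set.mem_Ici.2 le_rfl) (Set.mem_Ici.2 hT) hT
  simp only [zero_mul, add_zero, sub_self, mul_zero, Finset.sum_const_zero] at this
  exact sub_nonneg.1 this

namespace Matrix

/-! ### Relative entropy through pairs of spectral projections, and a variational bound. -/

section RelativeEntropy

variable {n ι κ : Type*} [Fintype n] [DecidableEq n] [Fintype ι] [Fintype κ]

/-- The relative entropy `tr (ρ log ρ) - tr (ρ log σ)`, for `ρ` supported by `σ`. -/
noncomputable def relEntropy (ρ σ : Matrix n n ℂ) : ℝ :=
  (ρ * cfc Real.log ρ).trace.re - (ρ * cfc Real.log σ).trace.re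

theorem re_trace_sum_smul_mul_sum_smul (c : ι → ℝ) (d : κ → ℝ) (R : ι → Matrix n n ℂ)
    (T : κ → Matrix n n ℂ) :
    ((∑ i, (c i : ℂ) • R i) * ∑ j, (d j : ℂ) • T j).trace.re =
      ∑ p : ι × κ, c p.1 * d p.2 * (R p.1 * T p.2).trace.re := by
  rw [Finset.sum_mul_sum, trace_sum, Complex.re_sum, Fintype.sum_prod_type]
  refine Finset.sum_congr rfl fun i _ => ?_
  rw [trace_sum, Complex.re_sum]
  refine Finset.sum_congr rfl fun j _ => ?_
  rw [smul_mul_smul_comm, trace_smul, smul_eq_mul, ← Complex.ofReal_mul, Complex.re_ofReal_mul]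

namespace IsSpectralResolution

variable {ρ σ : Matrix n n ℂ} {x : ι → ℝ} {y : κ → ℝ} {R : ι → Matrix n n ℂ}
  {T : κ → Matrix n n ℂ}

theorem weight_nonneg (hρ : IsSpectralResolution ρ x R) (hσ : IsSpectralResolution σ y T)
    (p : ι × κ) : 0 ≤ (R p.1 * T p.2).trace.re :=
  (hρ.posSemidef_proj p.1).re_trace_mul_nonneg (hσ.posSemidef_proj p.2)

theorem val_nonneg_of_trace_proj_mul_ne_zero (hρ : IsSpectralResolution ρ x R)
    (hp : ρ.PosSemidef) (i : ι) {Q : Matrix n n ℂ} (h : (R i * Q).trace.re ≠ 0) : 0 ≤ x i :=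
  hρ.val_nonneg hp i fun h0 => h (by simp [h0])

theorem val_nonneg_of_trace_mul_proj_ne_zero (hρ : IsSpectralResolution ρ x R)
    (hp : ρ.PosSemidef) (i : ι) {Q : Matrix n n ℂ} (h : (Q * R i).trace.re ≠ 0) : 0 ≤ x i :=
  hρ.val_nonneg hp i fun h0 => h (by simp [h0])

theorem sum_weight_mul (hρ : IsSpectralResolution ρ x R) (hσ : IsSpectralResolution σ y T) :
    ∑ p : ι × κ, (R p.1 * T p.2).trace.re * x p.1 = ρ.trace.re := by
  have h := re_trace_sum_smul_mul_sum_smul x (fun _ => 1) R T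
  simp only [Complex.ofReal_one, one_smul, hσ.sum_proj, mul_one, ← hρ.sum_smul_proj] at h
  rw [h]
  exact Finset.sum_congr rfl fun p _ => mul_comm _ _

/-- Inserting `∑ Tⱼ = 1` into `tr (ρ log ρ)` puts both traces on the same index set: this is the
classical relative entropy of the Nussbaum-Szkoła weights `w x` and `w y`. -/
theorem relEntropy_eq (hρ : IsSpectralResolution ρ x R) (hσ : IsSpectralResolution σ y T) :
    relEntropy ρ σ = ∑ p : ι × κ,
      (R p.1 * T p.2).trace.re * x p.1 * (Real.log (x p.1) - Real.log (y p.2)) := by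
  have h1 : (ρ * cfc Real.log ρ).trace.re =
      ∑ p : ι × κ, x p.1 * Real.log (x p.1) * (R p.1 * T p.2).trace.re := by
    have h := re_trace_sum_smul_mul_sum_smul (fun i => x i * Real.log (x i)) (fun _ => 1) R T
    simp only [Complex.ofReal_one, one_smul, hσ.sum_proj, mul_one] at h
    rw [← h, hρ.cfc_eq, Finset.mul_sum]
    congr 2
    refine Finset.sum_congr rfl fun i _ => ?_
    rw [mul_smul_comm, hρ.mul_proj, smul_smul, Complex.ofReal_mul, mul_comm]
  have h2 : (ρ * cfc Real.log σ).trace.re =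
      ∑ p : ι × κ, x p.1 * Real.log (y p.2) * (R p.1 * T p.2).trace.re := by
    rw [hσ.cfc_eq, ← re_trace_sum_smul_mul_sum_smul x (fun j => Real.log (y j)), ← hρ.sum_smul_proj]
  rw [relEntropy, h1, h2, ← Finset.sum_sub_distrib]
  exact Finset.sum_congr rfl fun p _ => by ring

/-- The domination `c ρ ≤ σ` forces the support condition: if `yⱼ = 0`, testing it on `Tⱼ` gives `tr
(ρ Tⱼ) ≤ 0`, and this trace is a sum of nonnegative terms. -/
theorem val_pos_of_smul_le (hρ : IsSpectralResolution ρ x R) (hσ : IsSpectralResolution σ y T)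
    (hρp : ρ.PosSemidef) (hσp : σ.PosSemidef) {c : ℝ} (hc : 0 < c)
    (hle : (σ - (c : ℂ) • ρ).PosSemidef) (p : ι × κ)
    (hne : (R p.1 * T p.2).trace.re * x p.1 ≠ 0) : 0 < y p.2 := by
  refine lt_of_le_of_ne
    (hσ.val_nonneg_of_trace_mul_proj_ne_zero hσp p.2 (left_ne_zero_of_mul hne)) fun h0 => hne ?_
  have h1 := hle.re_trace_mul_nonneg (hσ.posSemidef_proj p.2)
  rw [sub_mul, hσ.mul_proj, ← h0, Complex.ofReal_zero, zero_smul, zero_sub, trace_neg,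
    smul_mul_assoc, trace_smul, smul_eq_mul, Complex.neg_re, Complex.re_ofReal_mul] at h1
  have h2 : (ρ * T p.2).trace.re = ∑ i, (R i * T p.2).trace.re * x i := by
    conv_lhs => rw [hρ.sum_smul_proj]
    rw [Finset.sum_mul, trace_sum, Complex.re_sum]
    refine Finset.sum_congr rfl fun i _ => ?_
    rw [smul_mul_assoc, trace_smul, smul_eq_mul, Complex.re_ofReal_mul, mul_comm]
  have h3 : ∀ i ∈ Finset.univ, 0 ≤ (R i * T p.2).trace.re * x i := fun i _ => by
    by_cases hw : (R i * T p.2).trace.re = 0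
    · simp [hw]
    · exact mul_nonneg (hρ.weight_nonneg hσ (i, p.2))
        (hρ.val_nonneg_of_trace_proj_mul_ne_zero hρp i hw)
  have h4 : ∑ i, (R i * T p.2).trace.re * x i = 0 := by
    refine le_antisymm ?_ (Finset.sum_nonneg h3)
    rw [← h2]
    have : c * (ρ * T p.2).trace.re ≤ 0 := by linarith
    exact nonpos_of_mul_nonpos_right this hc
  exact (Finset.sum_eq_zero_iff_of_nonneg h3).1 h4 p.1 (Finset.mem_univ _)

/-- The sum on the right is the supremum of the left hand side over all `X`. -/
theorem re_trace_sub_le_sum_weight_mul (hρ : IsSpectralResolution ρ x R)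
    (hσ : IsSpectralResolution σ y T) (hρp : ρ.PosSemidef) (hσp : σ.PosSemidef)
    {X : Matrix n n ℂ} (hX : X.IsHermitian) {t : ℝ} (ht : 0 < t) :
    2 * (ρ * X).trace.re - ((X * σ * X).trace.re + t * (X * ρ * X).trace.re) ≤
      ∑ p : ι × κ, (R p.1 * T p.2).trace.re * (x p.1 ^ 2 / (y p.2 + t * x p.1)) := by
  have h1 : (ρ * X).trace.re = ∑ p : ι × κ, x p.1 * (R p.1 * (T p.2 * X)).trace.re := by
    have h := re_trace_sum_smul_mul_sum_smul x (fun _ => 1) R (fun j => T j * X)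
    simp only [Complex.ofReal_one, one_smul, mul_one, ← hρ.sum_smul_proj, ← Finset.sum_mul,
      hσ.sum_proj, one_mul] at h
    exact h
  -- Cyclicity lets `σ` act through `Tⱼ` and `ρ` through `Rᵢ`, so both quadratic terms involve the
  -- same numbers `tr (Rᵢ X Tⱼ X)`.
  have h2 : (X * σ * X).trace.re = ∑ p : ι × κ, y p.2 * (R p.1 * (X * T p.2 * X)).trace.re := by
    have h := re_trace_sum_smul_mul_sum_smul (fun _ => 1) y R (fun j => X * T j * X)
    simp only [Complex.ofReal_one, one_smul, one_mul, hρ.sum_proj] at h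
    rw [← h]
    conv_lhs => rw [hσ.sum_smul_proj]
    simp only [Finset.mul_sum, Finset.sum_mul, mul_smul_comm, smul_mul_assoc]
  have h3 : (X * ρ * X).trace.re = ∑ p : ι × κ, x p.1 * (R p.1 * (X * T p.2 * X)).trace.re := by
    have h := re_trace_sum_smul_mul_sum_smul x (fun _ => 1) R (fun j => X * T j * X)
    simp only [Complex.ofReal_one, one_smul, mul_one, ← hρ.sum_smul_proj, ← Finset.sum_mul,
      ← Finset.mul_sum, hσ.sum_proj] at h
    rw [← h, mul_assoc, trace_mul_comm, mul_assoc]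
  rw [h1, h2, h3, Finset.mul_sum, Finset.mul_sum, ← Finset.sum_add_distrib,
    ← Finset.sum_sub_distrib]
  refine Finset.sum_le_sum fun p _ => ?_
  by_cases hR : R p.1 = 0
  · simp [hR]
  by_cases hT : T p.2 = 0
  · simp [hT]
  have hx := hρ.val_nonneg hρp _ hR
  have hy := hσ.val_nonneg hσp _ hT
  -- Positivity of `tr (Rᵢ (c - X) Tⱼ (c - X))`, expanded in `c`; the two cross terms have equal
  -- real parts.
  have hquad : ∀ c : ℝ, 0 ≤ c ^ 2 * (R p.1 * T p.2).trace.re -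
      2 * c * (R p.1 * (T p.2 * X)).trace.re + (R p.1 * (X * T p.2 * X)).trace.re := by
    intro c
    have hM : ((c : ℂ) • (1 : Matrix n n ℂ) - X)ᴴ = (c : ℂ) • (1 : Matrix n n ℂ) - X := by
      rw [conjTranspose_sub, conjTranspose_smul, hX.eq, conjTranspose_one]
      simp
    have h := (hρ.posSemidef_proj p.1).re_trace_mul_nonneg
      ((hσ.posSemidef_proj p.2).mul_mul_conjTranspose_same ((c : ℂ) • (1 : Matrix n n ℂ) - X))
    have hconj : (R p.1 * (X * T p.2)).trace.re = (R p.1 * (T p.2 * X)).trace.re := by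
      rw [← Complex.conj_re (R p.1 * (T p.2 * X)).trace]
      change _ = (star (R p.1 * (T p.2 * X)).trace).re
      rw [← trace_conjTranspose, conjTranspose_mul, conjTranspose_mul, hX.eq,
        (hρ.isHermitian p.1).eq, (hσ.isHermitian p.2).eq, trace_mul_comm]
    rw [hM] at h
    have hexp : R p.1 * (((c : ℂ) • (1 : Matrix n n ℂ) - X) * T p.2 *
        ((c : ℂ) • (1 : Matrix n n ℂ) - X)) = ((c ^ 2 : ℝ) : ℂ) • (R p.1 * T p.2)
        - (c : ℂ) • (R p.1 * (T p.2 * X)) - (c : ℂ) • (R p.1 * (X * T p.2))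
        + R p.1 * (X * T p.2 * X) := by
      simp only [sub_mul, mul_sub, smul_mul_assoc, mul_smul_comm, one_mul, mul_one, smul_sub,
        smul_smul, pow_two, Complex.ofReal_mul]
      abel
    rw [hexp] at h
    simp only [trace_add, trace_sub, trace_smul, smul_eq_mul, Complex.add_re, Complex.sub_re,
      Complex.re_ofReal_mul, hconj] at h
    linarith
  -- If `y + t x = 0`, then `x = y = 0` and all terms vanish; otherwise complete the square with `c
  -- = x / (y + t x)`.
  rcases (add_nonneg hy (mul_nonneg ht.le hx)).eq_or_lt with hs | hs
  · have hx0 : x p.1 = 0 := by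
      have : t * x p.1 = 0 := le_antisymm (by linarith) (mul_nonneg ht.le hx)
      exact (mul_eq_zero.1 this).resolve_left ht.ne'
    have hy0 : y p.2 = 0 := by simpa [hx0] using hs.symm
    simp [hx0, hy0]
  · have h := mul_nonneg hs.le (hquad (x p.1 / (y p.2 + t * x p.1)))
    have he : (y p.2 + t * x p.1) * ((x p.1 / (y p.2 + t * x p.1)) ^ 2 * (R p.1 * T p.2).trace.re -
        2 * (x p.1 / (y p.2 + t * x p.1)) * (R p.1 * (T p.2 * X)).trace.re +
        (R p.1 * (X * T p.2 * X)).trace.re) =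
        (R p.1 * T p.2).trace.re * (x p.1 ^ 2 / (y p.2 + t * x p.1)) -
        2 * (x p.1 * (R p.1 * (T p.2 * X)).trace.re) +
        (y p.2 + t * x p.1) * (R p.1 * (X * T p.2 * X)).trace.re := by
      field_simp
    rw [he] at h
    linarith

end IsSpectralResolution

/-- The Kadison-Schwarz inequality for a resolution `E` of the identity, in a state `σ`. -/
theorem re_trace_mul_mul_le_sum_sq {E : κ → Matrix n n ℂ} (hE : ∀ j, (E j).PosSemidef)
    (hE1 : ∑ j, E j = 1) (z : κ → ℝ) {σ X : Matrix n n ℂ} (hσ : σ.PosSemidef)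
    (hX : X = ∑ j, (z j : ℂ) • E j) :
    (X * σ * X).trace.re ≤ ∑ j, z j ^ 2 * (E j * σ).trace.re := by
  have hXh : Xᴴ = X := by
    rw [hX, conjTranspose_sum]
    refine Finset.sum_congr rfl fun j _ => ?_
    rw [conjTranspose_smul, (hE j).isHermitian.eq]
    simp
  have hM : ∀ j, ((z j : ℂ) • (1 : Matrix n n ℂ) - X)ᴴ = (z j : ℂ) • (1 : Matrix n n ℂ) - X := by
    intro j
    rw [conjTranspose_sub, conjTranspose_smul, hXh, conjTranspose_one]
    simp
  -- The gap in Kadison-Schwarz is the manifestly positive `∑ (zⱼ - X) Eⱼ (zⱼ - X)`.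
  have hsum : ∑ j, ((z j : ℂ) • (1 : Matrix n n ℂ) - X) * E j *
      ((z j : ℂ) • (1 : Matrix n n ℂ) - X) = ∑ j, ((z j ^ 2 : ℝ) : ℂ) • E j - X * X := by
    have hterm : ∀ j, ((z j : ℂ) • (1 : Matrix n n ℂ) - X) * E j *
        ((z j : ℂ) • (1 : Matrix n n ℂ) - X) = ((z j ^ 2 : ℝ) : ℂ) • E j - ((z j : ℂ) • E j) * X
        - X * ((z j : ℂ) • E j) + X * E j * X := by
      intro j
      simp only [sub_mul, mul_sub, smul_mul_assoc, mul_smul_comm, one_mul, mul_one, smul_sub,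
        smul_smul, pow_two, Complex.ofReal_mul]
      abel
    simp only [hterm, Finset.sum_add_distrib, Finset.sum_sub_distrib, ← Finset.sum_mul,
      ← Finset.mul_sum, ← hX, hE1, mul_one]
    abel
  have h : 0 ≤ ∑ j, (((z j : ℂ) • (1 : Matrix n n ℂ) - X) * E j *
      ((z j : ℂ) • (1 : Matrix n n ℂ) - X) * σ).trace.re := Finset.sum_nonneg fun j _ => by
    have h1 := (hE j).mul_mul_conjTranspose_same ((z j : ℂ) • (1 : Matrix n n ℂ) - X)
    rw [hM] at h1
    exact h1.re_trace_mul_nonneg hσ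
  rw [← Complex.re_sum, ← trace_sum, ← Finset.sum_mul, hsum, sub_mul, trace_sub, Complex.sub_re,
    Finset.sum_mul, trace_sum, Complex.re_sum] at h
  have h2 : (X * σ * X).trace = (X * X * σ).trace := by
    rw [trace_mul_comm, mul_assoc]
  rw [h2]
  simp only [smul_mul_assoc, trace_smul, smul_eq_mul, Complex.re_ofReal_mul] at h
  linarith

namespace IsSpectralResolution

variable {ρ σ : Matrix n n ℂ} {x : ι → ℝ} {y : κ → ℝ} {R : ι → Matrix n n ℂ}
  {T : κ → Matrix n n ℂ}

/-- The trial operator `X = ∑ zⱼ Eⱼ` in the variational bound; Kadison-Schwarz, for `σ` and for `ρ`,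
turns the quadratic terms into outcome statistics. -/
theorem sum_outcome_le_sum_weight_mul {μ : Type*} [Fintype μ] (hρ : IsSpectralResolution ρ x R)
    (hσ : IsSpectralResolution σ y T) (hρp : ρ.PosSemidef) (hσp : σ.PosSemidef)
    {E : μ → Matrix n n ℂ} (hE : ∀ j, (E j).PosSemidef) (hE1 : ∑ j, E j = 1) (z : μ → ℝ)
    {t : ℝ} (ht : 0 < t) :
    ∑ j, (2 * z j * (E j * ρ).trace.re -
        z j ^ 2 * ((E j * σ).trace.re + t * (E j * ρ).trace.re)) ≤
      ∑ p : ι × κ, (R p.1 * T p.2).trace.re * (x p.1 ^ 2 / (y p.2 + t * x p.1)) := by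
  set X := ∑ j, (z j : ℂ) • E j with hX
  have hXh : X.IsHermitian := by
    unfold IsHermitian
    rw [hX, conjTranspose_sum]
    refine Finset.sum_congr rfl fun j _ => ?_
    rw [conjTranspose_smul, (hE j).isHermitian.eq]
    simp
  have h1 := hρ.re_trace_sub_le_sum_weight_mul hσ hρp hσp hXh ht
  have h2 := re_trace_mul_mul_le_sum_sq hE hE1 z hσp hX
  have h3 := mul_le_mul_of_nonneg_left (re_trace_mul_mul_le_sum_sq hE hE1 z hρp hX) ht.le
  have h4 : (ρ * X).trace.re = ∑ j, z j * (E j * ρ).trace.re := by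
    rw [trace_mul_comm, hX, Finset.sum_mul, trace_sum, Complex.re_sum]
    refine Finset.sum_congr rfl fun j _ => ?_
    rw [smul_mul_assoc, trace_smul, smul_eq_mul, Complex.re_ofReal_mul]
  refine le_trans (le_of_eq ?_) (le_trans (sub_le_sub_left (add_le_add h2 h3) _) h1)
  rw [h4, Finset.mul_sum, Finset.mul_sum, ← Finset.sum_add_distrib, ← Finset.sum_sub_distrib]
  exact Finset.sum_congr rfl fun j _ => by ring

end IsSpectralResolution

end RelativeEntropy

end Matrix

/-! ### Functionals on a system as traces against its elements. -/

namespace FiniteQuantumSystem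

variable {n : Type*} [Fintype n] [DecidableEq n]

open Matrix

/-- The trace pairing is nondegenerate on `𝒜`: testing `E` against `star E`, which lies in `𝒜`,
gives `tr (E Eᴴ)`. In finite dimension it therefore reaches every functional. -/
theorem exists_trace_mul_eq (𝒜 : FiniteQuantumSystem n) (φ : 𝒜 →ₗ[ℂ] ℂ) :
    ∃ E : 𝒜, ∀ a : 𝒜, φ a = ((E : Matrix n n ℂ) * a).trace := by
  let Φ : 𝒜 →ₗ[ℂ] Module.Dual ℂ 𝒜 := LinearMap.mk₂ ℂ
    (fun E a : 𝒜 => ((E : Matrix n n ℂ) * (a : Matrix n n ℂ)).trace)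
    (fun E F a => by simp [add_mul]) (fun c E a => by simp)
    (fun E a b => by simp [mul_add]) (fun c E a => by simp)
  have hinj : Function.Injective Φ := by
    rw [← LinearMap.ker_eq_bot, LinearMap.ker_eq_bot']
    intro E hE
    have h : ((E : Matrix n n ℂ) * (E : Matrix n n ℂ)ᴴ).trace = 0 :=
      LinearMap.congr_fun hE (star E)
    exact Subtype.ext (trace_mul_conjTranspose_self_eq_zero_iff.1 h)
  have : FiniteDimensional ℂ 𝒜 :=
    inferInstanceAs (FiniteDimensional ℂ (Subalgebra.toSubmodule 𝒜.toSubalgebra))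
  obtain ⟨E, hE⟩ := (LinearMap.injective_iff_surjective_of_finrank_eq_finrank
    (Subspace.dual_finrank_eq (K := ℂ) (V := 𝒜)).symm).1 hinj φ
  exact ⟨E, fun a => by rw [← hE]; rfl⟩

/-- A positive functional on `𝒜` is given by a positive element of `𝒜`. -/
theorem exists_posSemidef_re_trace_mul_eq (𝒜 : FiniteQuantumSystem n) (φ : 𝒜 →ₗ[ℂ] ℂ)
    (hφ : ∀ a : 𝒜, (a : Matrix n n ℂ).PosSemidef → 0 ≤ (φ a).re) :
    ∃ E ∈ 𝒜, E.PosSemidef ∧ ∀ a : 𝒜, (a : Matrix n n ℂ).IsHermitian →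
      (E * (a : Matrix n n ℂ)).trace.re = (φ a).re := by
  obtain ⟨F, hF⟩ := exists_trace_mul_eq 𝒜 φ
  -- The Hermitian part of the representing element has the same real trace against Hermitian `a`.
  set E : Matrix n n ℂ := (2⁻¹ : ℂ) • ((F : Matrix n n ℂ) + (F : Matrix n n ℂ)ᴴ) with hE
  have hmem : E ∈ 𝒜 := 𝒜.toSubalgebra.smul_mem
    (add_mem F.2 (star_mem F.2 : star (F : Matrix n n ℂ) ∈ 𝒜)) _
  have hherm : E.IsHermitian := by
    unfold IsHermitian
    rw [hE, conjTranspose_smul, conjTranspose_add, conjTranspose_conjTranspose, add_comm]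
    simp
  have htr : ∀ a : 𝒜, (a : Matrix n n ℂ).IsHermitian →
      (E * (a : Matrix n n ℂ)).trace.re = (φ a).re := by
    intro a ha
    have h1 : ((F : Matrix n n ℂ)ᴴ * (a : Matrix n n ℂ)).trace = star (φ a) := by
      rw [hF, ← trace_conjTranspose, conjTranspose_mul, ha.eq, trace_mul_comm]
    rw [hE, smul_mul_assoc, add_mul, trace_smul, trace_add, h1, ← hF]
    simp only [smul_eq_mul, Complex.star_def, Complex.add_conj]
    rw [Complex.ofReal_mul, Complex.ofReal_ofNat, ← mul_assoc, inv_mul_cancel₀ two_ne_zero, one_mul,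
      Complex.ofReal_re]
  refine ⟨E, hmem, ?_, htr⟩
  -- The spectral projections of `E` lie in `𝒜`, so `φ` can be tested on them; this makes their
  -- eigenvalues nonnegative.
  obtain ⟨s, R, hR, hRmem⟩ := exists_isSpectralResolution 𝒜 hherm hmem
  have hterm : ∀ i : s, ((i : ℝ) • R i).PosSemidef := by
    intro i
    by_cases h0 : R i = 0
    · rw [h0, smul_zero]
      exact PosSemidef.zero
    have h1 := hφ ⟨R i, hRmem i⟩ (hR.posSemidef_proj i)
    rw [← htr _ (hR.isHermitian i)] at h1
    simp only [hR.mul_proj, trace_smul, smul_eq_mul, Complex.re_ofReal_mul] at h1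
    have h2 : 0 < (R i).trace := lt_of_le_of_ne (hR.trace_proj_nonneg i)
      fun h => h0 ((hR.posSemidef_proj i).trace_eq_zero_iff.1 h.symm)
    exact (hR.posSemidef_proj i).smul
      (nonneg_of_mul_nonneg_left h1 (by simpa using (Complex.lt_def.1 h2).1))
  rw [hR.sum_smul_proj]
  simp only [Complex.coe_smul]
  exact posSemidef_sum _ fun i _ => hterm i

end FiniteQuantumSystem

/-! ### Monotonicity of the relative entropy under measurements. -/

namespace FiniteQuantumSystem

section Measurement

variable {n m : Type*} [Fintype n] [DecidableEq n] [Fintype m] [DecidableEq m]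
  {𝒜 : FiniteQuantumSystem n} {ℬ : FiniteQuantumSystem m}

open Matrix

/-- Complete positivity with the trivial ancilla `ℂ`. -/
theorem IsCompletelyPositive.map_posSemidef {α : 𝒜 →ₗ[ℂ] ℬ} (hα : IsCompletelyPositive α) {a : 𝒜}
    (ha : (a : Matrix n n ℂ).PosSemidef) : (α a : Matrix m m ℂ).PosSemidef := by
  have h := hα 1 ⊤ 1 (fun _ => a) (fun _ => 1) (by
    simpa using ha.kronecker (PosSemidef.one : (1 : Matrix (Fin 1) (Fin 1) ℂ).PosSemidef))
  have h1 := h.submatrix (fun i : m => (i, (0 : Fin 1)))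
  convert h1 using 1
  ext i j
  simp

/-- A decomposition of the trace of `𝒜` into positive functionals is given by a resolution of the
identity. -/
theorem exists_resolution_re_trace_mul_eq {κ : Type*} [Fintype κ] (𝒜 : FiniteQuantumSystem n)
    (φ : κ → 𝒜 →ₗ[ℂ] ℂ)
    (hφ : ∀ j, ∀ a : 𝒜, (a : Matrix n n ℂ).PosSemidef → 0 ≤ (φ j a).re)
    (hsum : ∀ a : 𝒜, ∑ j, φ j a = (a : Matrix n n ℂ).trace) :
    ∃ E : κ → Matrix n n ℂ, (∀ j, (E j).PosSemidef) ∧ ∑ j, E j = 1 ∧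
      ∀ j, ∀ a : 𝒜, (a : Matrix n n ℂ).IsHermitian →
        (E j * (a : Matrix n n ℂ)).trace.re = (φ j a).re := by
  choose E hmem hpos htr using fun j => exists_posSemidef_re_trace_mul_eq 𝒜 (φ j) (hφ j)
  refine ⟨E, hpos, ?_, htr⟩
  rw [← sub_eq_zero]
  set G := ∑ j, E j - 1 with hG
  have hGmem : G ∈ 𝒜 := sub_mem (sum_mem fun j _ => hmem j) (one_mem 𝒜)
  have hGh : Gᴴ = G := by
    rw [hG, conjTranspose_sub, conjTranspose_sum, conjTranspose_one]
    congr 1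
    exact Finset.sum_congr rfl fun j _ => (hpos j).isHermitian.eq
  -- As `G` itself is a Hermitian element of `𝒜`, the trace identities apply to it: `tr G² = tr G -
  -- tr G`.
  have h0 : (G * G).trace.re = 0 := by
    conv_lhs => rw [hG]
    rw [sub_mul, one_mul, trace_sub, Complex.sub_re, Finset.sum_mul, trace_sum, Complex.re_sum,
      Finset.sum_congr rfl fun j _ => htr j ⟨G, hGmem⟩ hGh, ← Complex.re_sum, hsum, sub_self]
  have h1 := (posSemidef_conjTranspose_mul_self G).trace_nonneg
  have h2 : (Gᴴ * G).trace = 0 :=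
    Complex.ext (by rw [hGh, h0]; rfl) (Complex.nonneg_iff.1 h1).2.symm
  exact trace_conjTranspose_mul_self_eq_zero_iff.1 h2

/-- Monotonicity of the relative entropy under a positive trace preserving map into a commutative
system. -/
theorem relEntropy_map_le_of_commute (D : 𝒜 →ₗ[ℂ] ℬ)
    (hpos : ∀ a : 𝒜, (a : Matrix n n ℂ).PosSemidef → (D a : Matrix m m ℂ).PosSemidef)
    (htr : ∀ a : 𝒜, (D a : Matrix m m ℂ).trace = (a : Matrix n n ℂ).trace)
    (hcomm : ∀ x y : ℬ, x * y = y * x) {ρ σ : 𝒜} (hρ : (ρ : Matrix n n ℂ).PosSemidef)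
    (hσ : (σ : Matrix n n ℂ).PosSemidef) {c : ℝ} (hc : 0 < c)
    (hle : ((σ - (c : ℂ) • ρ : 𝒜) : Matrix n n ℂ).PosSemidef) :
    relEntropy (D ρ : Matrix m m ℂ) (D σ : Matrix m m ℂ) ≤
      relEntropy (ρ : Matrix n n ℂ) (σ : Matrix n n ℂ) := by
  have hDρ := hpos ρ hρ
  have hDσ := hpos σ hσ
  have hDle : ((D σ : Matrix m m ℂ) - (c : ℂ) • (D ρ : Matrix m m ℂ)).PosSemidef := by
    have := hpos _ hle
    rwa [map_sub, map_smul] at this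
  obtain ⟨s, R, hR, -⟩ := exists_isSpectralResolution 𝒜 hρ.isHermitian ρ.2
  obtain ⟨u, T, hT, -⟩ := exists_isSpectralResolution 𝒜 hσ.isHermitian σ.2
  obtain ⟨s', R', hR', hRmem⟩ := exists_isSpectralResolution ℬ hDρ.isHermitian (D ρ).2
  obtain ⟨u', T', hT', hTmem⟩ := exists_isSpectralResolution ℬ hDσ.isHermitian (D σ).2
  have hcom : ∀ p : s' × u', T' p.2 * R' p.1 = R' p.1 * T' p.2 := fun p =>
    congrArg Subtype.val (hcomm ⟨T' p.2, hTmem p.2⟩ ⟨R' p.1, hRmem p.1⟩)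
  -- Here commutativity enters: products of spectral projections of `D ρ` and `D σ` are again
  -- positive.
  have hQ : ∀ p : s' × u', (R' p.1 * T' p.2).PosSemidef := fun p => by
    have h := (hT'.posSemidef_proj p.2).mul_mul_conjTranspose_same (R' p.1)
    rwa [(hR'.isHermitian p.1).eq, mul_assoc, hcom, ← mul_assoc, hR'.mul_self] at h
  let φ : s' × u' → 𝒜 →ₗ[ℂ] ℂ := fun p =>
    traceLinearMap m ℂ ℂ ∘ₗ LinearMap.mulLeft ℂ (R' p.1 * T' p.2) ∘ₗ ℬ.subtype.toLinearMap ∘ₗ D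
  have hφ : ∀ p a, φ p a = (R' p.1 * T' p.2 * (D a : Matrix m m ℂ)).trace := fun p a => rfl
  obtain ⟨E, hE, hE1, hEtr⟩ := exists_resolution_re_trace_mul_eq 𝒜 φ
    (fun p a ha => (hQ p).re_trace_mul_nonneg (hpos a ha))
    (fun a => by
      simp only [hφ]
      rw [← trace_sum, ← Finset.sum_mul, Fintype.sum_prod_type,
        ← Fintype.sum_mul_sum, hR'.sum_proj, hT'.sum_proj, one_mul, one_mul, htr])
  have hEρ : ∀ p : s' × u', (E p * (ρ : Matrix n n ℂ)).trace.re =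
      p.1 * (R' p.1 * T' p.2).trace.re := fun p => by
    rw [hEtr p ρ hρ.isHermitian, hφ, trace_mul_comm, ← mul_assoc, hR'.mul_proj, smul_mul_assoc,
      trace_smul, smul_eq_mul, Complex.re_ofReal_mul]
  have hEσ : ∀ p : s' × u', (E p * (σ : Matrix n n ℂ)).trace.re =
      p.2 * (R' p.1 * T' p.2).trace.re := fun p => by
    rw [hEtr p σ hσ.isHermitian, hφ, mul_assoc, hT'.proj_mul, mul_smul_comm,
      trace_smul, smul_eq_mul, Complex.re_ofReal_mul]
  rw [hR.relEntropy_eq hT, hR'.relEntropy_eq hT']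
  refine sum_mul_log_sub_log_le_of_sum_sq_div_le
    (fun p h => hR'.val_nonneg_of_trace_proj_mul_ne_zero hDρ p.1 h)
    (fun p h => hR'.val_pos_of_smul_le hT' hDρ hDσ hc hDle p h)
    (fun p h => hR.val_nonneg_of_trace_proj_mul_ne_zero hρ p.1 h)
    (fun p h => hR.val_pos_of_smul_le hT hρ hσ hc hle p h) ?_ ?_
  · rw [hR'.sum_weight_mul hT', hR.sum_weight_mul hT, htr]
  · intro t ht
    -- The value `z = x' / (y' + t x')` maximises `2 z w' x' - z² w' (y' + t x')`, with maximum `w'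
    -- x'² / (y' + t x')`. A zero denominator gives `0` on both sides.
    refine le_trans (le_of_eq ?_) (hR.sum_outcome_le_sum_weight_mul hT hρ hσ hE hE1
      (fun p : s' × u' => (p.1 : ℝ) / ((p.2 : ℝ) + t * (p.1 : ℝ))) ht)
    refine Finset.sum_congr rfl fun p _ => ?_
    rw [hEρ, hEσ]
    by_cases h0 : (p.2 : ℝ) + t * (p.1 : ℝ) = 0
    · simp [h0]
    · field_simp
      ring

end Measurement

end FiniteQuantumSystem

/-! ### Mutual information as an average of relative entropies. -/

namespace Matrix

theorem kronecker_finsetSum {n m ι : Type*} (A : Matrix n n ℂ) (s : Finset ι)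
    (B : ι → Matrix m m ℂ) : A ⊗ₖ (∑ i ∈ s, B i) = ∑ i ∈ s, A ⊗ₖ B i := by
  ext
  simp [sum_apply, Finset.mul_sum]

theorem finsetSum_kronecker {n m ι : Type*} (s : Finset ι) (A : ι → Matrix n n ℂ)
    (B : Matrix m m ℂ) : (∑ i ∈ s, A i) ⊗ₖ B = ∑ i ∈ s, A i ⊗ₖ B := by
  ext
  simp [sum_apply, Finset.sum_mul]

end Matrix

namespace FiniteQuantumSystem

section MutualInformation

open Matrix

variable {n m ι : Type*} [Fintype n] [DecidableEq n] [Fintype m] [DecidableEq m] [Fintype ι]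
  {𝒜 : FiniteQuantumSystem n} {ℬ : FiniteQuantumSystem m}

theorem entropy_eq_of_isSpectralResolution {X : Matrix n n ℂ} {x : ι → ℝ} {R : ι → Matrix n n ℂ}
    (h : IsSpectralResolution X x R) :
    entropy X = -∑ i, Real.log (x i) * x i * (R i).trace.re := by
  rw [entropy, h.trace_mul_cfc, Complex.re_sum]
  congr 1
  refine Finset.sum_congr rfl fun i _ => ?_
  rw [← Complex.ofReal_mul, Complex.re_ofReal_mul]

namespace SpectralDecomposition

variable {A : 𝒜}

theorem isSpectralResolution (S : SpectralDecomposition A ι) :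
    IsSpectralResolution (A : Matrix n n ℂ) S.eigenvalue (fun i => (S.proj i : Matrix n n ℂ)) where
  isHermitian i := congrArg Subtype.val (S.isMinimalProjection i).isStarProjection.isSelfAdjoint
  mul_self i := congrArg Subtype.val (S.isMinimalProjection i).isStarProjection.isIdempotentElem
  mul_of_ne i j hij := congrArg Subtype.val (S.orthogonal i j hij)
  sum_proj := by simpa using congrArg Subtype.val S.sum_proj
  sum_smul_proj := by simpa using congrArg Subtype.val S.sum_eigenvalue_smul_proj

theorem coe_proj_ne_zero (S : SpectralDecomposition A ι) (i : ι) :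
    (S.proj i : Matrix n n ℂ) ≠ 0 := fun h => (S.isMinimalProjection i).ne_zero (Subtype.ext h)

theorem trace_proj_pos (S : SpectralDecomposition A ι) (i : ι) :
    0 < (S.proj i : Matrix n n ℂ).trace :=
  lt_of_le_of_ne (S.isSpectralResolution.trace_proj_nonneg i) fun h =>
    S.coe_proj_ne_zero i ((S.isSpectralResolution.posSemidef_proj i).trace_eq_zero_iff.1 h.symm)

theorem ofReal_re_trace_proj (S : SpectralDecomposition A ι) (i : ι) :
    (((S.proj i : Matrix n n ℂ).trace.re : ℝ) : ℂ) = (S.proj i : Matrix n n ℂ).trace :=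
  Complex.ext rfl (Complex.lt_def.1 (S.trace_proj_pos i)).2

/-- The probability of the `i`-th pure state. -/
noncomputable def probability (S : SpectralDecomposition A ι) (i : ι) : ℝ :=
  S.eigenvalue i * (S.proj i : Matrix n n ℂ).trace.re

theorem probability_nonneg (S : SpectralDecomposition A ι) (hA : (A : Matrix n n ℂ).PosSemidef)
    (i : ι) : 0 ≤ S.probability i :=
  mul_nonneg (S.isSpectralResolution.val_nonneg hA i (S.coe_proj_ne_zero i))
    (Complex.lt_def.1 (S.trace_proj_pos i)).1.le

theorem pureState_posSemidef (S : SpectralDecomposition A ι) (i : ι) :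
    (S.pureState i : Matrix n n ℂ).PosSemidef :=
  (S.isSpectralResolution.posSemidef_proj i).smul (inv_nonneg.2 (S.trace_proj_pos i).le)

theorem trace_pureState (S : SpectralDecomposition A ι) (i : ι) :
    (S.pureState i : Matrix n n ℂ).trace = 1 := by
  change ((S.proj i : Matrix n n ℂ).trace⁻¹ • (S.proj i : Matrix n n ℂ)).trace = 1
  rw [trace_smul, smul_eq_mul, inv_mul_cancel₀ (S.trace_proj_pos i).ne']

theorem sum_probability_smul_pureState (S : SpectralDecomposition A ι) :
    A = ∑ i, (S.probability i : ℂ) • S.pureState i := by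
  conv_lhs => rw [S.sum_eigenvalue_smul_proj]
  refine Finset.sum_congr rfl fun i _ => ?_
  rw [pureState, smul_smul, probability, Complex.ofReal_mul, ofReal_re_trace_proj, mul_assoc,
    mul_inv_cancel₀ (S.trace_proj_pos i).ne', mul_one]

theorem map_eq_sum_probability_smul (S : SpectralDecomposition A ι) (W : 𝒜 →ₗ[ℂ] ℬ) :
    W A = ∑ i, (S.probability i : ℂ) • W (S.pureState i) := by
  conv_lhs => rw [S.sum_probability_smul_pureState]
  rw [map_sum]
  exact Finset.sum_congr rfl fun i _ => map_smul _ _ _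

/-- The chain rule for a block diagonal state: the joint eigenprojections are `Pᵢ ⊗ Rᵢₖ` with
eigenvalues `aᵢ k`, and the logarithm of the product splits. -/
theorem entropy_jointState (S : SpectralDecomposition A ι) (W : 𝒜 →ₗ[ℂ] ℬ)
    (hpos : ∀ a : 𝒜, (a : Matrix n n ℂ).PosSemidef → (W a : Matrix m m ℂ).PosSemidef)
    (htr : ∀ a : 𝒜, (W a : Matrix m m ℂ).trace = (a : Matrix n n ℂ).trace) :
    entropy (S.jointState W) = entropy (A : Matrix n n ℂ) +
      ∑ i, S.probability i * entropy (W (S.pureState i) : Matrix m m ℂ) := by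
  have hA := S.isSpectralResolution
  choose s R hR _ using fun i => exists_isSpectralResolution ℬ
    (hpos _ (S.pureState_posSemidef i)).isHermitian (W (S.pureState i)).2
  have hJ : IsSpectralResolution (S.jointState W)
      (fun p : Σ i, s i => S.eigenvalue p.1 * (p.2 : ℝ))
      (fun p => (S.proj p.1 : Matrix n n ℂ) ⊗ₖ R p.1 p.2) := by
    refine ⟨?_, ?_, ?_, ?_, ?_⟩
    · intro p
      unfold IsHermitian
      rw [conjTranspose_kronecker, (hA.isHermitian p.1).eq, ((hR p.1).isHermitian p.2).eq]
    · intro p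
      rw [← mul_kronecker_mul, hA.mul_self, (hR p.1).mul_self]
    · rintro ⟨i, k⟩ ⟨j, l⟩ hne
      rw [← mul_kronecker_mul]
      by_cases hij : i = j
      · subst hij
        rw [(hR i).mul_of_ne k l fun h => hne (by rw [h]), kronecker_zero]
      · rw [hA.mul_of_ne i j hij, zero_kronecker]
    · rw [Fintype.sum_sigma]
      simp only [← kronecker_finsetSum, ← finsetSum_kronecker, (hR _).sum_proj, hA.sum_proj,
        one_kronecker_one]
    · rw [Fintype.sum_sigma, jointState]
      refine Finset.sum_congr rfl fun i _ => ?_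
      conv_lhs => rw [(hR i).sum_smul_proj]
      rw [kronecker_finsetSum, Finset.smul_sum]
      refine Finset.sum_congr rfl fun k _ => ?_
      rw [kronecker_smul, smul_smul, Complex.ofReal_mul]
  rw [entropy_eq_of_isSpectralResolution hJ, entropy_eq_of_isSpectralResolution hA,
    Fintype.sum_sigma, ← Finset.sum_neg_distrib, ← Finset.sum_neg_distrib,
    ← Finset.sum_add_distrib]
  refine Finset.sum_congr rfl fun i _ => ?_
  have hone : ∑ k : s i, (k : ℝ) * (R i k).trace.re = 1 := by
    have h := htr (S.pureState i)
    rw [S.trace_pureState, (hR i).sum_smul_proj, trace_sum] at h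
    have h' := congrArg Complex.re h
    simpa [Complex.re_sum, trace_smul] using h'
  have hterm : ∀ k : s i, Real.log (S.eigenvalue i * (k : ℝ)) * (S.eigenvalue i * (k : ℝ)) *
      ((S.proj i : Matrix n n ℂ) ⊗ₖ R i k).trace.re =
      Real.log (S.eigenvalue i) * S.eigenvalue i * (S.proj i : Matrix n n ℂ).trace.re *
        ((k : ℝ) * (R i k).trace.re) +
      S.probability i * (Real.log k * k * (R i k).trace.re) := by
    intro k
    rw [trace_kronecker, ← S.ofReal_re_trace_proj, Complex.re_ofReal_mul, Complex.ofReal_re,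
      probability]
    -- Splitting the logarithm needs nonzero factors; otherwise both sides vanish, by `0 log 0 = 0`.
    by_cases h1 : S.eigenvalue i = 0
    · simp [h1]
    by_cases h2 : (k : ℝ) = 0
    · simp [h2]
    rw [Real.log_mul h1 h2]
    ring
  simp only [hterm]
  rw [Finset.sum_add_distrib, ← Finset.mul_sum, ← Finset.mul_sum, hone,
    entropy_eq_of_isSpectralResolution (hR i)]
  ring

/-- The mutual information is the Holevo quantity of the ensemble of output states. -/
theorem mutualInformation_eq_sum_relEntropy (S : SpectralDecomposition A ι) (W : 𝒜 →ₗ[ℂ] ℬ)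
    (hpos : ∀ a : 𝒜, (a : Matrix n n ℂ).PosSemidef → (W a : Matrix m m ℂ).PosSemidef)
    (htr : ∀ a : 𝒜, (W a : Matrix m m ℂ).trace = (a : Matrix n n ℂ).trace) :
    S.mutualInformation W = ∑ i, S.probability i *
      relEntropy (W (S.pureState i) : Matrix m m ℂ) (W A : Matrix m m ℂ) := by
  have hB : entropy (W A : Matrix m m ℂ) = -∑ i, S.probability i *
      ((W (S.pureState i) : Matrix m m ℂ) * cfc Real.log (W A : Matrix m m ℂ)).trace.re := by
    have h : (W A : Matrix m m ℂ) =
        ∑ i, (S.probability i : ℂ) • (W (S.pureState i) : Matrix m m ℂ) := by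
      simpa using congrArg Subtype.val (S.map_eq_sum_probability_smul W)
    rw [entropy]
    -- Only the factor outside the logarithm is expanded as a mixture.
    conv_lhs => enter [1, 1, 1, 1]; rw [h]
    rw [Finset.sum_mul, trace_sum, Complex.re_sum]
    congr 1
    refine Finset.sum_congr rfl fun i _ => ?_
    rw [smul_mul_assoc, trace_smul, smul_eq_mul, Complex.re_ofReal_mul]
  rw [mutualInformation, S.entropy_jointState W hpos htr, hB, add_sub_add_left_eq_sub,
    ← Finset.sum_neg_distrib, ← Finset.sum_sub_distrib]
  refine Finset.sum_congr rfl fun i _ => ?_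
  rw [relEntropy, entropy]
  ring

/-- What remains of the mixture is the sum of its other components. This provides the domination
constant `c = pᵢ` for monotonicity. -/
theorem map_sub_smul_pureState_posSemidef (S : SpectralDecomposition A ι) (W : 𝒜 →ₗ[ℂ] ℬ)
    (hpos : ∀ a : 𝒜, (a : Matrix n n ℂ).PosSemidef → (W a : Matrix m m ℂ).PosSemidef)
    (hA : (A : Matrix n n ℂ).PosSemidef) (i : ι) :
    ((W A - (S.probability i : ℂ) • W (S.pureState i) : ℬ) : Matrix m m ℂ).PosSemidef := by
  classical
  have h : W A - (S.probability i : ℂ) • W (S.pureState i) =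
      ∑ j ∈ Finset.univ.erase i, (S.probability j : ℂ) • W (S.pureState j) := by
    rw [S.map_eq_sum_probability_smul W, ← Finset.add_sum_erase _ _ (Finset.mem_univ i),
      add_sub_cancel_left]
  rw [h, AddSubmonoidClass.coe_finsetSum]
  refine posSemidef_sum _ fun j _ => ?_
  exact (hpos _ (S.pureState_posSemidef j)).smul
    (by exact_mod_cast S.probability_nonneg hA j : (0 : ℂ) ≤ S.probability j)

end SpectralDecomposition

end MutualInformation

end FiniteQuantumSystem

theorem mainTheorem4 {n₁ n₂ n₃ : Type*} [Fintype n₁] [DecidableEq n₁] [Fintype n₂] [DecidableEq n₂]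
    [Fintype n₃] [DecidableEq n₃]
    (𝒜₁ : FiniteQuantumSystem n₁) (𝒜₂ : FiniteQuantumSystem n₂) (𝒜₃ : FiniteQuantumSystem n₃)
    (W : 𝒜₁ →ₗ[ℂ] 𝒜₂) (hW : FiniteQuantumSystem.IsPhysicalMap W)
    (D : 𝒜₂ →ₗ[ℂ] 𝒜₃) (hD : FiniteQuantumSystem.IsMeasurement D)
    (A : 𝒜₁) (hA : FiniteQuantumSystem.IsPhysicalState A)
    {ι : Type*} [Fintype ι] (S : FiniteQuantumSystem.SpectralDecomposition A ι) :
    S.mutualInformation (D ∘ₗ W) ≤ S.mutualInformation W := by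
  have hWpos : ∀ a : 𝒜₁, (a : Matrix n₁ n₁ ℂ).PosSemidef → (W a : Matrix n₂ n₂ ℂ).PosSemidef :=
    fun a => hW.completelyPositive.map_posSemidef
  have hDpos : ∀ a : 𝒜₂, (a : Matrix n₂ n₂ ℂ).PosSemidef → (D a : Matrix n₃ n₃ ℂ).PosSemidef :=
    fun a => hD.isPhysicalMap.completelyPositive.map_posSemidef
  have hDtr := hD.isPhysicalMap.trace_preserving
  rw [S.mutualInformation_eq_sum_relEntropy W hWpos hW.trace_preserving,
    S.mutualInformation_eq_sum_relEntropy (D ∘ₗ W) (fun a ha => hDpos _ (hWpos a ha))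
      (fun a => (hDtr (W a)).trans (hW.trace_preserving a))]
  refine Finset.sum_le_sum fun i _ => ?_
  -- A component of probability zero contributes nothing and must be split off, since `pᵢ` serves as
  -- the positive domination constant.
  rcases (S.probability_nonneg hA.posSemidef i).eq_or_lt with h0 | h0
  · rw [← h0, zero_mul, zero_mul]
  · exact mul_le_mul_of_nonneg_left (FiniteQuantumSystem.relEntropy_map_le_of_commute D hDpos hDtr
      hD.commutative (hWpos _ (S.pureState_posSemidef i)) (hWpos _ hA.posSemidef) h0
      (S.map_sub_smul_pureState_posSemidef W hWpos hA.posSemidef i)) h0.le
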